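/- **Theorem.** Identify $\mathbb{C}\otimes_{\mathbb R}\mathbb{H}$ with $\mathbb{C}^4$ via the basis $1\otimes 1,1\otimes i,1\otimes j,1\otimes k$. For an integer $k\ge 1$ let $\sigma_k:\mathbb{C}^4\to\mathbb{C}^4$ be the $k$-th power map of the algebra $\mathbb{C}\otimes\mathbb{H}$, and let $$\Omega=\{(z_0,z_1,z_2,z_3)\in\mathbb{C}^4 : z_1^2+z_2^2+z_3^2\neq 0,\ z_0^2+z_1^2+z_2^2+z_3^2\neq0,\ z_0\ne 0\}.$$ Let $\mathcal U\subseteq\mathbb{C}$ be a nonempty open set that is symmetric under complex conjugation and each of whose connected components is simply connected (for instance a conjugation-symmetric simply connected domain, or the union of a simply connected domain in the upper half-plane and its complex conjugate). For $G:\mathcal U\to\mathbb{C}^4$ let $TG(z)=\overline{G(\bar z)}$, with coordinatewise conjugation. Let $F:\mathcal U\to\mathbb{C}^4$ be a stem function, i.e. $TF=F$, with $F(\mathcal U)\subseteq\Omega$. Then, for every $k\geq 1$ (even or odd), there exist $k$ pairwise distinct functions $G_1,\dots,G_k:\mathcal U\to\mathbb{C}^4$ such that $$\sigma_k\circ G_m=F,\qquad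 TG_m=G_m\qquad(m=1,\dots,k),$$ and if $F$ is continuous, then $G_1,\dots,G_k$ can be taken continuous. Consequently, let $\mathbb{S}=\{I\in\mathbb{H}: I^2=-1\}$ and $U=\{\alpha+I\beta : \alpha+\imath\beta\in\mathcal U,\ I\in\mathbb{S}\}$. A stem function $G$, written $G=G'+\sqrt{-1}\,G''$ with $G',G'':\mathcal U\to\mathbb H$, induces the slice function $\mathcal I(G):U\to\mathbb H$, $\alpha+I\beta\mapsto G'(\alpha+\imath\beta)+I\,G''(\alpha+\imath\beta)$, and the $\star$-product of slice functions is $\mathcal I(G)\star\mathcal I(H)=\mathcal I(GH)$, with pointwise product $GH$ in $\mathbb C\otimes\mathbb H$. Then the functions $g_m=\mathcal I(G_m)$ are $k$ pairwise distinct slice functions on $U$ with $g_m^{\star k}=f$, where $f=\mathcal I(F)$. -/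

import Mathlib

open Complex

noncomputable section

namespace SliceRoots

/-- The quaternions. -/
abbrev Quat : Type := Quaternion ℝ

/-- The underlying space `ℂ⁴` of the complexified quaternion algebra `ℂ ⊗ ℍ`, in the coordinates
`(z₀, z₁, z₂, z₃)` relative to the basis `1 ⊗ 1, 1 ⊗ i, 1 ⊗ j, 1 ⊗ k`. -/
abbrev C4 : Type := Fin 4 → ℂ

/-- An element of `ℂ⁴` as an element of the algebra `ℂ ⊗ ℍ`, realised as the quaternion algebra
with complex coefficients. -/
def toAlg (v : C4) : Quaternion ℂ := ⟨v 0, v 1, v 2, v 3⟩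

/-- The coordinates in `ℂ⁴` of an element of `ℂ ⊗ ℍ`. -/
def ofAlg (a : Quaternion ℂ) : C4 := ![a.re, a.imI, a.imJ, a.imK]

/-- The product of `ℂ ⊗ ℍ`, in coordinates. -/
def mul (v w : C4) : C4 := ofAlg (toAlg v * toAlg w)

/-- `σ_k`: the `k`-th power map of `ℂ ⊗ ℍ`, in coordinates. -/
def sigma (k : ℕ) (v : C4) : C4 := ofAlg (toAlg v ^ k)

/-- The first component `w₀ ∈ ℍ` of `w = w₀ + √-1 w₁ ∈ ℂ ⊗ ℍ`. -/
def part0 (w : C4) : Quat := ⟨(w 0).re, (w 1).re, (w 2).re, (w 3).re⟩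

/-- The second component `w₁ ∈ ℍ` of `w = w₀ + √-1 w₁ ∈ ℂ ⊗ ℍ`. -/
def part1 (w : C4) : Quat := ⟨(w 0).im, (w 1).im, (w 2).im, (w 3).im⟩

/-- The element `p + √-1 q` of `ℂ ⊗ ℍ`. -/
def mk (p q : Quat) : C4 :=
  ![⟨p.re, q.re⟩, ⟨p.imI, q.imI⟩, ⟨p.imJ, q.imJ⟩, ⟨p.imK, q.imK⟩]

/-- The conjugation `w₀ + √-1 w₁ ↦ w₀ - √-1 w₁`, i.e. complex conjugation of each coordinate. -/
def conj4 (w : C4) : C4 := fun i => (starRingEnd ℂ) (w i)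

/-- `z₁² + z₂² + z₃²`, the square of the vector part. -/
def vecSq (v : C4) : ℂ := v 1 ^ 2 + v 2 ^ 2 + v 3 ^ 2

/-- The open set `Ω ⊆ ℂ⁴`. -/
def Omega : Set C4 := {v | vecSq v ≠ 0 ∧ v 0 ^ 2 + vecSq v ≠ 0 ∧ v 0 ≠ 0}

/-- The sphere `𝕊` of imaginary units of `ℍ`. -/
def imUnits : Set Quat := {I | I * I = -1}

/-- `π(z, I) = Re z + I Im z`. -/
def proj (z : ℂ) (I : Quat) : Quat := (z.re : Quat) + I * (z.im : Quat)

/-- `π(w, I) = w₀ + I w₁` for `w = w₀ + √-1 w₁ ∈ ℂ ⊗ ℍ`. -/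
def projAlg (w : C4) (I : Quat) : Quat := part0 w + I * part1 w

/-- The circular set `U = π(𝒰 × 𝕊) ⊆ ℍ`. -/
def circ (𝒰 : Set ℂ) : Set Quat := {q | ∃ z ∈ 𝒰, ∃ I ∈ imUnits, q = proj z I}

/-- `TG(z) = conj (G (conj z))`. -/
def T (G : ℂ → C4) : ℂ → C4 := fun z => conj4 (G ((starRingEnd ℂ) z))

/-- `F` is a stem function on `𝒰`: `F (conj z) = conj (F z)`. -/
def IsStem (𝒰 : Set ℂ) (F : ℂ → C4) : Prop :=
  ∀ z ∈ 𝒰, F ((starRingEnd ℂ) z) = conj4 (F z)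

/-- `f = 𝓘(F)` on `U = π(𝒰 × 𝕊)`: `f(π(z, I)) = π(F(z), I)`. -/
def Induces (𝒰 : Set ℂ) (F : ℂ → C4) (f : Quat → Quat) : Prop :=
  ∀ z ∈ 𝒰, ∀ I ∈ imUnits, f (proj z I) = projAlg (F z) I

/-- The slice function `𝓘(F)`, evaluated at `q = α + I β` with `α = q₀`, `β = ‖q_v‖` and
`I = q_v / ‖q_v‖` (for real `q` the value is `F₀(q)`, as `F₁` vanishes there). -/
def sliceOf (F : ℂ → C4) (q : Quat) : Quat :=
  projAlg (F ⟨q.re, ‖q.im‖⟩) (‖q.im‖⁻¹ • q.im)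

/-- The quaternion `i`. -/
def unitI : Quat := ⟨0, 1, 0, 0⟩

/-- The stem function of a slice function `f`, recovered from the values of `f` on the slice `ℂ_i`
by the representation formula (`stemOf_eq` shows that it is the stem function of `f`). -/
def stemOf (f : Quat → Quat) (z : ℂ) : C4 :=
  mk ((1 / 2 : ℝ) • (f (proj z unitI) + f (proj z (-unitI))))
    (-unitI * ((1 / 2 : ℝ) • (f (proj z unitI) - f (proj z (-unitI)))))

/-- The slice product `f ⋆ g = 𝓘(FG)` of the slice functions `f = 𝓘(F)` and `g = 𝓘(G)`. -/
def starMul (f g : Quat → Quat) : Quat → Quat :=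
  sliceOf fun z => mul (stemOf f z) (stemOf g z)

/-- The `k`-th `⋆`-power of a slice function. -/
def starPow (f : Quat → Quat) : ℕ → Quat → Quat
  | 0 => fun _ => 1
  | k + 1 => starMul (starPow f k) f

/-- The product of `ℂ ⊗ ℍ` is
`(p + √-1 q)(p' + √-1 q') = (p p' - q q') + √-1 (p q' + q p')`. -/
theorem mul_mk (p q p' q' : Quat) :
    mul (mk p q) (mk p' q') = mk (p * p' - q * q') (p * q' + q * p') := by
  have hre (v : C4) : (toAlg v).re = v 0 := rfl
  have hI (v : C4) : (toAlg v).imI = v 1 := rfl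
  have hJ (v : C4) : (toAlg v).imJ = v 2 := rfl
  have hK (v : C4) : (toAlg v).imK = v 3 := rfl
  ext i
  fin_cases i <;> apply Complex.ext <;>
    simp [mul, ofAlg, hre, hI, hJ, hK] <;> simp [mk] <;> ring

/-- An element of `𝕊` has vanishing real part and Euclidean norm one. -/
theorem imUnits_spec {I : Quat} (hI : I ∈ imUnits) :
    I.re = 0 ∧ I.imI ^ 2 + I.imJ ^ 2 + I.imK ^ 2 = 1 := by
  have h : I * I = -1 := hI
  have h0 := congrArg QuaternionAlgebra.re h
  have h1 := congrArg QuaternionAlgebra.imI h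
  have h2 := congrArg QuaternionAlgebra.imJ h
  have h3 := congrArg QuaternionAlgebra.imK h
  simp only [Quaternion.re_mul, Quaternion.re_neg, Quaternion.re_one] at h0
  simp only [Quaternion.imI_mul, Quaternion.imI_neg, Quaternion.imI_one] at h1
  simp only [Quaternion.imJ_mul, Quaternion.imJ_neg, Quaternion.imJ_one] at h2
  simp only [Quaternion.imK_mul, Quaternion.imK_neg, Quaternion.imK_one] at h3
  have hr : I.re = 0 := by
    by_contra hne
    have a1 : I.imI = 0 := by
      have : I.re * I.imI = 0 := by linarith
      exact (mul_eq_zero.mp this).resolve_left hne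
    have a2 : I.imJ = 0 := by
      have : I.re * I.imJ = 0 := by linarith
      exact (mul_eq_zero.mp this).resolve_left hne
    have a3 : I.imK = 0 := by
      have : I.re * I.imK = 0 := by linarith
      exact (mul_eq_zero.mp this).resolve_left hne
    rw [a1, a2, a3] at h0
    nlinarith [mul_self_nonneg I.re]
  rw [hr] at h0
  exact ⟨hr, by nlinarith⟩

theorem unitI_sq : unitI * unitI = -1 := by
  have hre : unitI.re = 0 := rfl
  have hI : unitI.imI = 1 := rfl
  have hJ : unitI.imJ = 0 := rfl
  have hK : unitI.imK = 0 := rfl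
  apply Quaternion.ext <;> simp [hre, hI, hJ, hK] <;> rfl

/-- A function induced by `F` has `F` as its stem function. -/
theorem stemOf_eq {𝒰 : Set ℂ} {F : ℂ → C4} {f : Quat → Quat} (h : Induces 𝒰 F f) {z : ℂ}
    (hz : z ∈ 𝒰) : stemOf f z = F z := by
  have h1 : unitI * unitI = -1 := unitI_sq
  have h2 : (-unitI) * (-unitI) = -1 := by rw [neg_mul_neg, h1]
  have e1 := h z hz unitI h1
  have e2 := h z hz (-unitI) h2
  have e3 : (1 / 2 : ℝ) • (projAlg (F z) unitI + projAlg (F z) (-unitI)) = part0 (F z) := by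
    rw [projAlg, projAlg, neg_mul, add_add_add_comm, add_neg_cancel, add_zero, ← two_smul ℝ,
      smul_smul]
    norm_num
  have e4 : -unitI * ((1 / 2 : ℝ) • (projAlg (F z) unitI - projAlg (F z) (-unitI)))
      = part1 (F z) := by
    rw [projAlg, projAlg, neg_mul unitI (part1 _), add_sub_add_left_eq_sub, sub_neg_eq_add,
      ← two_smul ℝ, smul_smul]
    norm_num
    rw [← mul_assoc, h1]
    simp
  rw [stemOf, e1, e2, e3, e4]
  ext i
  fin_cases i <;> rfl

/-- A stem function `F` induces the slice function `sliceOf F`. -/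
theorem induces_sliceOf {𝒰 : Set ℂ} {F : ℂ → C4} (hF : IsStem 𝒰 F) :
    Induces 𝒰 F (sliceOf F) := by
  intro z hz I hI
  obtain ⟨h0, h1⟩ := imUnits_spec hI
  have hIm : I.im = I := by ext <;> simp [h0]
  have hre : (proj z I).re = z.re := by simp [proj, h0]
  have him : (proj z I).im = z.im • I := by
    ext <;> simp [proj, h0, mul_comm]
  have hn : ‖I‖ = 1 := by
    have : ‖I‖ * ‖I‖ = 1 := by
      rw [← Quaternion.normSq_eq_norm_mul_self, Quaternion.normSq_def', h0]
      linarith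
    nlinarith [norm_nonneg I]
  have hnorm : ‖(proj z I).im‖ = |z.im| := by
    rw [him, norm_smul, hn, mul_one, Real.norm_eq_abs]
  rw [sliceOf, hnorm, hre, him, smul_smul]
  rcases lt_trichotomy z.im 0 with hlt | heq | hgt
  · have hz' : (⟨z.re, |z.im|⟩ : ℂ) = (starRingEnd ℂ) z := by
      apply Complex.ext <;> simp [abs_of_neg hlt]
    have hs : |z.im|⁻¹ * z.im = -1 := by
      rw [abs_of_neg hlt, inv_neg, neg_mul, inv_mul_cancel₀ hlt.ne]
    have hp0 : part0 (conj4 (F z)) = part0 (F z) := by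
      apply Quaternion.ext <;> simp [part0, conj4]
    have hp1 : part1 (conj4 (F z)) = -part1 (F z) := by
      apply Quaternion.ext <;>
        simp only [Quaternion.re_neg, Quaternion.imI_neg, Quaternion.imJ_neg, Quaternion.imK_neg] <;>
        simp [part1, conj4]
    rw [hz', hs, hF z hz, projAlg, projAlg, hp0, hp1]
    simp
  · have hz' : (⟨z.re, |z.im|⟩ : ℂ) = z := by
      apply Complex.ext <;> simp [heq]
    have hc : (starRingEnd ℂ) z = z := by
      apply Complex.ext <;> simp [heq]
    have hp1 : part1 (F z) = 0 := by
      have hh := hF z hz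
      rw [hc] at hh
      have hi (i : Fin 4) : (F z i).im = 0 := by
        have := congrArg Complex.im (congrFun hh i)
        simp only [conj4, Complex.conj_im] at this
        linarith
      apply Quaternion.ext <;> simp [part1, hi] <;> rfl
    rw [hz', projAlg, projAlg, hp1]
    simp
  · have hz' : (⟨z.re, |z.im|⟩ : ℂ) = z := by
      apply Complex.ext <;> simp [abs_of_pos hgt]
    have hs : |z.im|⁻¹ * z.im = 1 := by
      rw [abs_of_pos hgt, inv_mul_cancel₀ hgt.ne']
    rw [hz', hs, one_smul]

end SliceRoots

end

open SliceRoots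

open SliceRoots

/-! Let `v` have vector part `w`, and let `s² = vecSq v ≠ 0`. Then `w² = -s²`, so `1` and `w` span a
copy of `ℂ × ℂ` in `ℂ ⊗ ℍ` in which `v` is the pair `(v₀ + i s, v₀ - i s)` (`ofEigen`,
`toAlg_ofEigen_mul`). A `k`-th root of `v` thus comes from `k`-th roots of two scalars, nonzero on
`Ω` because their product is `v₀² + vecSq v`. If `s` is conjugation-symmetric along `F`, conjugation
swaps the two factors (`conj4_ofEigen`). So a root `A` of `F₀ + i s` may be chosen freely, and `B z
= conj (A (conj z))` is a root of `F₀ - i s` that makes the result a stem function. The `k` roots of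
unity in `A` give `k` solutions. Simple connectivity supplies continuous branches, and reflection
makes `s` symmetric (`exists_symmetric_sqrt`). -/

namespace SliceRoots

/-! ### Scalar roots and their symmetry -/

/-- A nowhere vanishing function on an open set with simply connected components has an `n`-th root,
which is continuous if the function is. -/
theorem exists_pow_eq_of_isSimplyConnected_components {𝒰 : Set ℂ} (ho : IsOpen 𝒰)
    (hsc : ∀ z ∈ 𝒰, IsSimplyConnected (connectedComponentIn 𝒰 z)) {n : ℕ} (hn : n ≠ 0)
    {q : ℂ → ℂ} (hq : ∀ z ∈ 𝒰, q z ≠ 0) :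
    ∃ r : ℂ → ℂ, (∀ z, r z ^ n = q z) ∧ (ContinuousOn q 𝒰 → ContinuousOn r 𝒰) := by
  by_cases hc : ContinuousOn q 𝒰
  -- Quantifying over sets makes the chosen branch depend on the component only, not on the point in
  -- it.
  · have key (C : Set ℂ) : ∃ r : ℂ → ℂ, (IsSimplyConnected C → IsOpen C → C ⊆ 𝒰 →
        ContinuousOn r C) ∧ ∀ z, r z ^ n = q z := by
      by_cases hC : IsSimplyConnected C ∧ IsOpen C ∧ C ⊆ 𝒰
      · obtain ⟨h1, h2, h3⟩ := hC
        obtain ⟨r, hr, hr'⟩ := exists_continuousOn_pow_eq h1 h2 (hc.mono h3)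
          (by rintro ⟨z, hz, h⟩; exact hq z (h3 hz) h) hn
        exact ⟨r, fun _ _ _ => hr, hr'⟩
      · choose r hr using fun z => IsAlgClosed.exists_pow_nat_eq (q z) (Nat.pos_of_ne_zero hn)
        exact ⟨r, fun h1 h2 h3 => absurd ⟨h1, h2, h3⟩ hC, hr⟩
    choose R hR hR' using key
    refine ⟨fun z => R (connectedComponentIn 𝒰 z) z, fun z => hR' _ z, fun _ z hz => ?_⟩
    have hCo : IsOpen (connectedComponentIn 𝒰 z) := ho.connectedComponentIn
    have hzC : connectedComponentIn 𝒰 z ∈ nhds z := hCo.mem_nhds (mem_connectedComponentIn hz)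
    have hcont := (hR _ (hsc z hz) hCo (connectedComponentIn_subset 𝒰 z)).continuousAt hzC
    refine (hcont.congr ?_).continuousWithinAt
    filter_upwards [hzC] with w hw
    rw [connectedComponentIn_eq hw]
  · choose r hr using fun z => IsAlgClosed.exists_pow_nat_eq (q z) (Nat.pos_of_ne_zero hn)
    exact ⟨r, hr, fun h => absurd h hc⟩

/-- A complex square root of a positive real number is real. -/
theorem conj_eq_of_sq_eq_ofReal {r : ℂ} {x : ℝ} (hx : 0 < x) (h : r ^ 2 = x) :
    (starRingEnd ℂ) r = r := by
  rw [Complex.conj_eq_iff_im]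
  have h1 := congrArg Complex.re h
  have h2 := congrArg Complex.im h
  simp only [pow_two, Complex.mul_re, Complex.mul_im, Complex.ofReal_re, Complex.ofReal_im]
    at h1 h2
  by_contra hne
  have h3 : r.re = 0 := by
    have : r.re * r.im = 0 := by linarith
    exact (mul_eq_zero.mp this).resolve_right hne
  rw [h3] at h1
  nlinarith [mul_self_nonneg r.im]

/-- A conjugation-symmetric nowhere vanishing function which is positive at real points has a
conjugation-symmetric square root, which is continuous if the function is. -/
theorem exists_symmetric_sqrt {𝒰 : Set ℂ} (ho : IsOpen 𝒰)
    (hsymm : ∀ z ∈ 𝒰, (starRingEnd ℂ) z ∈ 𝒰)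
    (hsc : ∀ z ∈ 𝒰, IsSimplyConnected (connectedComponentIn 𝒰 z))
    {q : ℂ → ℂ} (hq : ∀ z ∈ 𝒰, q z ≠ 0)
    (hqs : ∀ z ∈ 𝒰, q ((starRingEnd ℂ) z) = (starRingEnd ℂ) (q z))
    (hqr : ∀ z ∈ 𝒰, z.im = 0 → ∃ x : ℝ, 0 < x ∧ q z = x) :
    ∃ s : ℂ → ℂ, (∀ z ∈ 𝒰, s z ^ 2 = q z) ∧
      (∀ z ∈ 𝒰, s ((starRingEnd ℂ) z) = (starRingEnd ℂ) (s z)) ∧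
      (ContinuousOn q 𝒰 → ContinuousOn s 𝒰) := by
  obtain ⟨r, hr, hrc⟩ := exists_pow_eq_of_isSimplyConnected_components ho hsc two_ne_zero hq
  have hreal (z : ℂ) (hz : z ∈ 𝒰) (h0 : z.im = 0) : (starRingEnd ℂ) (r z) = r z := by
    obtain ⟨x, hx, hxq⟩ := hqr z hz h0
    exact conj_eq_of_sq_eq_ofReal hx ((hr z).trans hxq)
  -- Reflection: `r` may fail to be symmetric, so only its values on the closed upper half-plane are
  -- kept. The two halves agree on the real axis, where `r` is real.
  let s : ℂ → ℂ := fun z => if 0 ≤ z.im then r z else (starRingEnd ℂ) (r ((starRingEnd ℂ) z))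
  have hpos (z : ℂ) (h : 0 ≤ z.im) : s z = r z := if_pos h
  have hneg (z : ℂ) (hz : z ∈ 𝒰) (h : z.im ≤ 0) :
      s z = (starRingEnd ℂ) (r ((starRingEnd ℂ) z)) := by
    rcases h.eq_or_lt with h | h
    · rw [hpos z h.ge, Complex.conj_eq_iff_im.mpr h, hreal z hz h]
    · exact if_neg h.not_ge
  refine ⟨s, fun z hz => ?_, fun z hz => ?_, fun hc => ?_⟩
  · rcases le_total 0 z.im with h | h
    · rw [hpos z h, hr]
    · rw [hneg z hz h, ← map_pow, hr, hqs z hz, Complex.conj_conj]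
  · rcases le_total 0 z.im with h | h
    · rw [hpos z h, hneg _ (hsymm z hz) (by simpa using h), Complex.conj_conj]
    · rw [hneg z hz h, hpos _ (by simpa using h), Complex.conj_conj]
  · have hup : ContinuousOn s (𝒰 ∩ {z | 0 ≤ z.im}) :=
      ((hrc hc).mono Set.inter_subset_left).congr fun z hz => hpos z hz.2
    have hlow : ContinuousOn s (𝒰 ∩ {z | z.im ≤ 0}) := by
      have : ContinuousOn (fun z => (starRingEnd ℂ) (r ((starRingEnd ℂ) z))) 𝒰 :=
        Complex.continuous_conj.comp_continuousOn
          ((hrc hc).comp Complex.continuous_conj.continuousOn hsymm)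
      exact (this.mono Set.inter_subset_left).congr fun z hz => hneg z hz.1 hz.2
    intro z hz
    have h1 : ContinuousWithinAt s (𝒰 ∩ {z | 0 ≤ z.im}) z := by
      by_cases h : 0 ≤ z.im
      · exact hup z ⟨hz, h⟩
      -- Continuity within a set is vacuous at a point outside its closure.
      · refine continuousWithinAt_of_notMem_closure fun hcl => h ?_
        exact (isClosed_le continuous_const Complex.continuous_im).closure_subset_iff.mpr
          Set.inter_subset_right hcl
    have h2 : ContinuousWithinAt s (𝒰 ∩ {z | z.im ≤ 0}) z := by
      by_cases h : z.im ≤ 0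
      · exact hlow z ⟨hz, h⟩
      · refine continuousWithinAt_of_notMem_closure fun hcl => h ?_
        exact (isClosed_le Complex.continuous_im continuous_const).closure_subset_iff.mpr
          Set.inter_subset_right hcl
    refine (h1.union h2).mono fun w hw => ?_
    rcases le_total 0 w.im with h | h
    · exact Or.inl ⟨hw, h⟩
    · exact Or.inr ⟨hw, h⟩

/-! ### The subalgebra `ℂ × ℂ` generated by a vector part -/

/-- The element `(a + b) / 2 + (a - b) / (2 i s) • w` of `ℂ ⊗ ℍ`, where `w` is the vector part of
`v`. If `s² = vecSq v ≠ 0`, then `(a, b) ↦ ofEigen s v a b` is an embedding of the algebra `ℂ × ℂ`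
sending `(v₀ + i s, v₀ - i s)` to `v`. -/
noncomputable def ofEigen (s : ℂ) (v : C4) (a b : ℂ) : C4 :=
  ![(a + b) / 2, (a - b) / (2 * Complex.I * s) * v 1, (a - b) / (2 * Complex.I * s) * v 2,
    (a - b) / (2 * Complex.I * s) * v 3]

/-- Since `w² = -s²`, the element `w / (i s)` squares to `1`, so `(1 ± w / (i s)) / 2` are
complementary orthogonal idempotents, with coefficients `a` and `b`. -/
theorem toAlg_ofEigen_mul {s : ℂ} {v : C4} (hs : s ^ 2 = vecSq v) (hs0 : s ≠ 0)
    (a b a' b' : ℂ) :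
    toAlg (ofEigen s v a b) * toAlg (ofEigen s v a' b') =
      toAlg (ofEigen s v (a * a') (b * b')) := by
  have hre (v : C4) : (toAlg v).re = v 0 := rfl
  have hI (v : C4) : (toAlg v).imI = v 1 := rfl
  have hJ (v : C4) : (toAlg v).imJ = v 2 := rfl
  have hK (v : C4) : (toAlg v).imK = v 3 := rfl
  have e0 (a b : ℂ) : ofEigen s v a b 0 = (a + b) / 2 := rfl
  have e1 (a b : ℂ) : ofEigen s v a b 1 = (a - b) / (2 * Complex.I * s) * v 1 := rfl
  have e2 (a b : ℂ) : ofEigen s v a b 2 = (a - b) / (2 * Complex.I * s) * v 2 := rfl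
  have e3 (a b : ℂ) : ofEigen s v a b 3 = (a - b) / (2 * Complex.I * s) * v 3 := rfl
  rw [vecSq] at hs
  have hI0 := Complex.I_ne_zero
  have hd : ((2 * Complex.I * s)⁻¹) ^ 2 * s ^ 2 = -(1 / 4) := by
    rw [inv_pow, mul_pow, mul_pow, Complex.I_sq]
    field_simp
    norm_num
  apply Quaternion.ext
  · simp only [Quaternion.re_mul, hre, hI, hJ, hK, e0, e1, e2, e3, div_eq_mul_inv (_ - _)]
    linear_combination (a - b) * (a' - b') * ((2 * Complex.I * s)⁻¹ ^ 2 * hs - hd)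
  all_goals
    simp only [Quaternion.imI_mul, Quaternion.imJ_mul, Quaternion.imK_mul, hre, hI, hJ, hK,
      e0, e1, e2, e3, div_eq_mul_inv (_ - _)]
    ring

theorem toAlg_ofEigen_pow {s : ℂ} {v : C4} (hs : s ^ 2 = vecSq v) (hs0 : s ≠ 0)
    (a b : ℂ) (n : ℕ) :
    toAlg (ofEigen s v a b) ^ n = toAlg (ofEigen s v (a ^ n) (b ^ n)) := by
  induction n with
  | zero => apply Quaternion.ext <;> simp [toAlg, ofEigen] <;> rfl
  | succ n ih => rw [pow_succ, ih, toAlg_ofEigen_mul hs hs0, ← pow_succ, ← pow_succ]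

theorem ofAlg_toAlg (v : C4) : ofAlg (toAlg v) = v := by
  ext i
  fin_cases i <;> rfl

theorem toAlg_ofAlg (a : Quaternion ℂ) : toAlg (ofAlg a) = a := rfl

theorem sigma_ofEigen {s : ℂ} {v : C4} (hs : s ^ 2 = vecSq v) (hs0 : s ≠ 0) {a b : ℂ} {n : ℕ}
    (ha : a ^ n = v 0 + Complex.I * s) (hb : b ^ n = v 0 - Complex.I * s) :
    sigma n (ofEigen s v a b) = v := by
  have hI0 := Complex.I_ne_zero
  have hd : (v 0 + Complex.I * s - (v 0 - Complex.I * s)) / (2 * Complex.I * s) = 1 := by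
    field_simp
    ring
  rw [sigma, toAlg_ofEigen_pow hs hs0, ofAlg_toAlg, ha, hb, ofEigen, hd]
  ext i
  fin_cases i <;> simp

/-- Coordinate `0` determines `a + b`. Some `v i` with `i ≠ 0` is nonzero because `s² ≠ 0`, and that
coordinate determines `a - b`. -/
theorem ofEigen_left_injective {s : ℂ} {v : C4} (hs : s ^ 2 = vecSq v) (hs0 : s ≠ 0)
    {a b a' b' : ℂ} (h : ofEigen s v a b = ofEigen s v a' b') : a = a' := by
  have hd : 2 * Complex.I * s ≠ 0 := by simp [hs0]
  have h0 : (a + b) / 2 = (a' + b') / 2 := congrFun h 0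
  have hi (i : Fin 4) (hv : v i ≠ 0) (h' : (a - b) / (2 * Complex.I * s) * v i =
      (a' - b') / (2 * Complex.I * s) * v i) : a = a' := by
    have := (div_left_inj' hd).mp (mul_right_cancel₀ hv h')
    linear_combination h0 + this / 2
  by_contra hne
  have z1 : v 1 = 0 := by_contra fun hv => hne (hi 1 hv (congrFun h 1))
  have z2 : v 2 = 0 := by_contra fun hv => hne (hi 2 hv (congrFun h 2))
  have z3 : v 3 = 0 := by_contra fun hv => hne (hi 3 hv (congrFun h 3))
  rw [vecSq, z1, z2, z3] at hs
  exact hs0 (by simpa using hs)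

/-- Conjugation changes the sign of `i` in the denominator `2 i s`, which exchanges the roles of `a`
and `b`. -/
theorem conj4_ofEigen (s : ℂ) (v : C4) (a b : ℂ) :
    conj4 (ofEigen s v a b) = ofEigen ((starRingEnd ℂ) s) (conj4 v) ((starRingEnd ℂ) b)
      ((starRingEnd ℂ) a) := by
  have hd (x : ℂ) : ((starRingEnd ℂ) a - (starRingEnd ℂ) b) / (-(2 * Complex.I * x)) =
      ((starRingEnd ℂ) b - (starRingEnd ℂ) a) / (2 * Complex.I * x) := by
    rw [div_neg, ← neg_div, neg_sub]
  ext i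
  fin_cases i <;> simp [conj4, ofEigen, hd, add_comm, Complex.conj_ofNat]

theorem vecSq_conj4 (v : C4) : vecSq (conj4 v) = (starRingEnd ℂ) (vecSq v) := by
  simp [vecSq, conj4]

theorem conj4_conj4 (v : C4) : conj4 (conj4 v) = v := by
  ext i
  simp [conj4]

/-- At real points a stem function has real coordinates; this gives the positivity needed by
`exists_symmetric_sqrt`. -/
theorem vecSq_eq_ofReal {v : C4} (hv : conj4 v = v) (h0 : vecSq v ≠ 0) :
    ∃ x : ℝ, 0 < x ∧ vecSq v = x := by
  have hi (i : Fin 4) : v i = ((v i).re : ℂ) := (Complex.conj_eq_iff_re.mp (congrFun hv i)).symm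
  have he : vecSq v = (((v 1).re ^ 2 + (v 2).re ^ 2 + (v 3).re ^ 2 : ℝ) : ℂ) := by
    rw [vecSq, hi 1, hi 2, hi 3]
    push_cast
    simp
  refine ⟨_, lt_of_le_of_ne (by positivity) fun h => h0 ?_, he⟩
  rw [he, ← h, Complex.ofReal_zero]

theorem isStem_iff_T {𝒰 : Set ℂ} {F : ℂ → C4} :
    IsStem 𝒰 F ↔ ∀ z ∈ 𝒰, T F z = F z := by
  refine forall₂_congr fun z _ => ?_
  constructor
  · intro h
    rw [T, h, conj4_conj4]
  · intro h
    rw [← h, T, conj4_conj4]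

/-! ### Star products and stem functions -/

theorem conj4_mul (v w : C4) : conj4 (mul v w) = mul (conj4 v) (conj4 w) := by
  have hre (v : C4) : (toAlg v).re = v 0 := rfl
  have hI (v : C4) : (toAlg v).imI = v 1 := rfl
  have hJ (v : C4) : (toAlg v).imJ = v 2 := rfl
  have hK (v : C4) : (toAlg v).imK = v 3 := rfl
  ext i
  fin_cases i <;> simp [mul, ofAlg, conj4, hre, hI, hJ, hK]

/-- The `⋆`-product of slice functions is induced by the product of the stem functions. -/
theorem induces_starMul {𝒰 : Set ℂ} (hsymm : ∀ z ∈ 𝒰, (starRingEnd ℂ) z ∈ 𝒰) {F H : ℂ → C4}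
    {f h : Quat → Quat} (hF : IsStem 𝒰 F) (hH : IsStem 𝒰 H) (hf : Induces 𝒰 F f)
    (hh : Induces 𝒰 H h) : Induces 𝒰 (fun z => mul (F z) (H z)) (starMul f h) := by
  -- `stemOf f` is known to equal `F` only on `𝒰`, so the symmetry of `𝒰` is needed to evaluate it
  -- at `conj z`.
  have hst : IsStem 𝒰 fun z => mul (stemOf f z) (stemOf h z) := by
    intro z hz
    simp only [stemOf_eq hf (hsymm z hz), stemOf_eq hh (hsymm z hz), stemOf_eq hf hz,
      stemOf_eq hh hz, hF z hz, hH z hz, conj4_mul]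
  intro z hz I hI
  simp only [starMul, induces_sliceOf hst z hz I hI, stemOf_eq hf hz, stemOf_eq hh hz]

theorem sigma_zero (v : C4) : sigma 0 v = ![1, 0, 0, 0] := by
  ext i
  fin_cases i <;> rfl

theorem sigma_succ (n : ℕ) (v : C4) : sigma (n + 1) v = mul (sigma n v) v := by
  rw [sigma, pow_succ, mul, sigma, toAlg_ofAlg]

theorem conj4_sigma (n : ℕ) (v : C4) : conj4 (sigma n v) = sigma n (conj4 v) := by
  induction n with
  | zero =>
    rw [sigma_zero, sigma_zero]
    ext i
    fin_cases i <;> simp [conj4]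
  | succ n ih => rw [sigma_succ, sigma_succ, conj4_mul, ih]

/-- The `n`-th `⋆`-power of a slice function is induced by the `n`-th power of its stem function. -/
theorem induces_starPow {𝒰 : Set ℂ} (hsymm : ∀ z ∈ 𝒰, (starRingEnd ℂ) z ∈ 𝒰) {F : ℂ → C4}
    {f : Quat → Quat} (hF : IsStem 𝒰 F) (hf : Induces 𝒰 F f) (n : ℕ) :
    Induces 𝒰 (fun z => sigma n (F z)) (starPow f n) := by
  induction n with
  | zero =>
    intro z _ I _
    have h0 (v : C4) : part0 (sigma 0 v) = 1 := by
      apply Quaternion.ext <;> simp [part0, sigma, ofAlg] <;> rfl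
    have h1 (v : C4) : part1 (sigma 0 v) = 0 := by
      apply Quaternion.ext <;> simp [part1, sigma, ofAlg] <;> rfl
    rw [projAlg, h0, h1, mul_zero, add_zero, starPow]
  | succ n ih =>
    have hst : IsStem 𝒰 fun z => sigma n (F z) := fun z hz => by
      simp only [hF z hz, conj4_sigma]
    simp only [sigma_succ]
    exact induces_starMul hsymm hst hF ih hf

/-- Functions induced by stem functions that differ at some point differ on the circular set. -/
theorem exists_ne_of_induces {𝒰 : Set ℂ} {F H : ℂ → C4} {f h : Quat → Quat}
    (hf : Induces 𝒰 F f) (hh : Induces 𝒰 H h) (hne : ∃ z ∈ 𝒰, F z ≠ H z) :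
    ∃ q ∈ circ 𝒰, f q ≠ h q := by
  by_contra! hcon
  obtain ⟨z, hz, hFH⟩ := hne
  have h2 : (-unitI) * (-unitI) = -1 := by rw [neg_mul_neg, unitI_sq]
  apply hFH
  -- `stemOf f z` involves only the values of `f` at `proj z (±unitI)`, and both points lie in `circ
  -- 𝒰`.
  rw [← stemOf_eq hf hz, ← stemOf_eq hh hz, stemOf, stemOf,
    hcon _ ⟨z, hz, unitI, unitI_sq, rfl⟩, hcon _ ⟨z, hz, -unitI, h2, rfl⟩]

/-! ### Construction of the roots -/

/-- A stem function with values in `Ω` has `k` distinct `k`-th roots among the stem functions. -/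
theorem exists_stem_roots {k : ℕ} (hk : k ≠ 0) {𝒰 : Set ℂ} (ho : IsOpen 𝒰) (hne : 𝒰.Nonempty)
    (hsymm : ∀ z ∈ 𝒰, (starRingEnd ℂ) z ∈ 𝒰)
    (hsc : ∀ z ∈ 𝒰, IsSimplyConnected (connectedComponentIn 𝒰 z))
    {F : ℂ → C4} (hF : IsStem 𝒰 F) (hFΩ : ∀ z ∈ 𝒰, F z ∈ Omega) :
    ∃ G : Fin k → ℂ → C4, (∀ m n, m ≠ n → ∃ z ∈ 𝒰, G m z ≠ G n z) ∧
      (∀ m, ∀ z ∈ 𝒰, sigma k (G m z) = F z) ∧ (∀ m, IsStem 𝒰 (G m)) ∧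
      (ContinuousOn F 𝒰 → ∀ m, ContinuousOn (G m) 𝒰) := by
  obtain ⟨s, hs, hss, hsc'⟩ := exists_symmetric_sqrt ho hsymm hsc (q := fun z => vecSq (F z))
    (fun z hz => (hFΩ z hz).1) (fun z hz => by simp only [hF z hz, vecSq_conj4])
    (fun z hz h0 => vecSq_eq_ofReal
      (by rw [← hF z hz, Complex.conj_eq_iff_im.mpr h0]) (hFΩ z hz).1)
  have hs0 (z : ℂ) (hz : z ∈ 𝒰) : s z ≠ 0 := fun h =>
    (hFΩ z hz).1 (by rw [← hs z hz, h, zero_pow two_ne_zero])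
  -- The product `(F₀ + i s)(F₀ - i s)` is `F₀² + vecSq F`, nonzero on `Ω`.
  have hp (z : ℂ) (hz : z ∈ 𝒰) : F z 0 + Complex.I * s z ≠ 0 := fun h => (hFΩ z hz).2.1 (by
    linear_combination (F z 0 - Complex.I * s z) * h - hs z hz + s z ^ 2 * Complex.I_sq)
  obtain ⟨a, ha, hac⟩ := exists_pow_eq_of_isSimplyConnected_components ho hsc hk hp
  have ha0 (z : ℂ) (hz : z ∈ 𝒰) : a z ≠ 0 := fun h =>
    hp z hz (by rw [← ha z, h, zero_pow hk])
  have hζ := Complex.isPrimitiveRoot_exp k hk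
  set ζ : ℂ := Complex.exp (2 * Real.pi * Complex.I / k)
  let A : Fin k → ℂ → ℂ := fun m z => ζ ^ (m : ℕ) * a z
  have hA (m : Fin k) (z : ℂ) : A m z ^ k = F z 0 + Complex.I * s z := by
    rw [mul_pow, ← pow_mul, mul_comm (m : ℕ), pow_mul, hζ.pow_eq_one, one_pow, one_mul, ha]
  -- The stem condition forces this choice: conjugation swaps the two factors. The branch `a` itself
  -- need not be symmetric.
  let B : Fin k → ℂ → ℂ := fun m z => (starRingEnd ℂ) (A m ((starRingEnd ℂ) z))
  have hB (m : Fin k) (z : ℂ) (hz : z ∈ 𝒰) : B m z ^ k = F z 0 - Complex.I * s z := by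
    rw [← map_pow, hA, hF z hz, hss z hz]
    simp [conj4, sub_eq_add_neg]
  refine ⟨fun m z => ofEigen (s z) (F z) (A m z) (B m z), fun m n hmn => ?_,
    fun m z hz => sigma_ofEigen (hs z hz) (hs0 z hz) (hA m z) (hB m z hz),
    fun m z hz => ?_, fun hc m => ?_⟩
  -- Any point of `𝒰` separates the roots, since the values `ζ ^ m * a z` with `m < k` are distinct
  -- when `a z ≠ 0`.
  · obtain ⟨z, hz⟩ := hne
    refine ⟨z, hz, fun h => hmn (Fin.ext (hζ.pow_inj m.2 n.2 ?_))⟩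
    exact mul_right_cancel₀ (ha0 z hz) (ofEigen_left_injective (hs z hz) (hs0 z hz) h)
  · simp only [conj4_ofEigen, hF z hz, hss z hz, B, Complex.conj_conj]
  · have hFc (i : Fin 4) : ContinuousOn (fun z => F z i) 𝒰 :=
      (continuous_apply i).comp_continuousOn hc
    have hsC : ContinuousOn s 𝒰 := hsc' (by
      simp only [vecSq]
      exact (((hFc 1).pow 2).add ((hFc 2).pow 2)).add ((hFc 3).pow 2))
    have hAc : ContinuousOn (A m) 𝒰 :=
      continuousOn_const.mul (hac ((hFc 0).add (continuousOn_const.mul hsC)))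
    have hBc : ContinuousOn (B m) 𝒰 := Complex.continuous_conj.comp_continuousOn
      (hAc.comp Complex.continuous_conj.continuousOn hsymm)
    have hd : ContinuousOn (fun z => (A m z - B m z) / (2 * Complex.I * s z)) 𝒰 :=
      (hAc.sub hBc).div (continuousOn_const.mul hsC) fun z hz => by simp [hs0 z hz]
    refine continuousOn_pi.mpr fun i => ?_
    fin_cases i
    · exact (hAc.add hBc).div_const 2
    · exact hd.mul (hFc 1)
    · exact hd.mul (hFc 2)
    · exact hd.mul (hFc 3)

end SliceRoots

theorem mainTheorem10 (k : ℕ) (hk : 1 ≤ k)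
    (𝒰 : Set ℂ) (h𝒰_open : IsOpen 𝒰) (h𝒰_ne : 𝒰.Nonempty)
    (h𝒰_symm : ∀ z ∈ 𝒰, (starRingEnd ℂ) z ∈ 𝒰)
    (h𝒰_sc : ∀ z ∈ 𝒰, IsSimplyConnected (connectedComponentIn 𝒰 z))
    (F : ℂ → C4) (hF : ∀ z ∈ 𝒰, T F z = F z) (hFΩ : ∀ z ∈ 𝒰, F z ∈ Omega)
    (f : Quat → Quat) (hf : Induces 𝒰 F f) :
    ∃ (G : Fin k → ℂ → C4) (g : Fin k → Quat → Quat),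
      (∀ m n, m ≠ n → ∃ z ∈ 𝒰, G m z ≠ G n z) ∧
      (∀ m, ∀ z ∈ 𝒰, sigma k (G m z) = F z) ∧
      (∀ m, ∀ z ∈ 𝒰, T (G m) z = G m z) ∧
      (ContinuousOn F 𝒰 → ∀ m, ContinuousOn (G m) 𝒰) ∧
      (∀ m, Induces 𝒰 (G m) (g m)) ∧
      (∀ m n, m ≠ n → ∃ q ∈ circ 𝒰, g m q ≠ g n q) ∧
      (∀ m, ∀ q ∈ circ 𝒰, starPow (g m) k q = f q) := by
  obtain ⟨G, hdist, hpow, hstem, hcont⟩ := exists_stem_roots (Nat.one_le_iff_ne_zero.mp hk)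
    h𝒰_open h𝒰_ne h𝒰_symm h𝒰_sc (isStem_iff_T.mpr hF) hFΩ
  have hind (m : Fin k) : Induces 𝒰 (G m) (sliceOf (G m)) := induces_sliceOf (hstem m)
  refine ⟨G, fun m => sliceOf (G m), hdist, hpow, fun m => isStem_iff_T.mp (hstem m), hcont, hind,
    fun m n hmn => exists_ne_of_induces (hind m) (hind n) (hdist m n hmn), ?_⟩
  rintro m q ⟨z, hz, I, hI, rfl⟩
  simp only [induces_starPow h𝒰_symm (hstem m) (hind m) k z hz I hI, hpow m z hz, hf z hz I hI]
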